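/- Let $(M,g)$ be a smooth Riemannian 3-manifold with Levi-Civita connection $\nabla$, curvature tensor $R(X,Y)Z=\nabla_X\nabla_YZ-\nabla_Y\nabla_XZ-\nabla_{[X,Y]}Z$, Ricci tensor $S$ ($S(Y,Z)$ is the trace of $X\mapsto R(X,Y)Z$) and scalar curvature $r$ (the $g$-trace of $S$). Let $(\phi,\xi,\eta)$ be a trans-Sasakian structure of type $(\alpha,\beta)$ on $(M,g)$: $\phi$ is a smooth $(1,1)$-tensor field, $\xi$ a smooth vector field, $\eta$ a 1-form and $\alpha,\beta$ are smooth real functions on $M$ such that, for all vector fields $X,Y$, $$\phi^2X=-X+\eta(X)\xi,\quad \eta(\xi)=1,\quad \eta(X)=g(X,\xi),$$ $$g(\phi X,\phi Y)=g(X,Y)-\eta(X)\eta(Y),\quad g(X,\phi Y)+g(Y,\phi X)=0,$$ $$(\nabla_X\phi)Y=\alpha\,[g(X,Y)\xi-\eta(Y)X]+\beta\,[g(\phi X,Y)\xi-\eta(Y)\phi X].$$ Suppose that $(g,\xi,\lambda,\mu)$ is an $\eta$-Einstein soliton, that is, $\lambda,\mu$ are real constants and $$\mathcal L_\xi g+2S+(2\lambda-r)g+2\mu\,\eta\otimes\eta=0,$$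 and that $R(\xi,X)\cdot S=0$, that is, $S(R(\xi,X)Y,Z)+S(Y,R(\xi,X)Z)=0$ for all vector fields $X,Y,Z$. Suppose finally that $\alpha^2\neq\beta^2$ in the sense that $\alpha^2-\beta^2$ does not vanish identically on any connected component of $M$ (for example, $\alpha^2\ne\beta^2$ everywhere, or $M$ is connected and $\alpha^2\ne\beta^2$ somewhere). Then $\beta=\mu$ on all of $M$, $(M,g)$ is an Einstein manifold ($S=c\,g$ for a real constant $c$), and its scalar curvature is constant, $r=6\lambda+6\beta$. -/

import Mathlib

open Bundle VectorField FiberBundle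
open scoped Manifold ContDiff Topology

noncomputable section

namespace RiemGeom

variable {E : Type*} [NormedAddCommGroup E] [NormedSpace ℝ E]
  {M : Type*} [TopologicalSpace M] [ChartedSpace E M] [IsManifold 𝓘(ℝ, E) ∞ M]
  [RiemannianBundle (fun x : M ↦ TangentSpace 𝓘(ℝ, E) x)]
  [IsContMDiffRiemannianBundle 𝓘(ℝ, E) ∞ E (fun x : M ↦ TangentSpace 𝓘(ℝ, E) x)]

local notation "⟪" v ", " w "⟫" => inner ℝ v w

/-- The right-hand side of the Koszul formula, divided by two:
`g(∇_X Y, Z) = koszul X Y Z`. -/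
def koszul (X Y Z : Π x : M, TangentSpace 𝓘(ℝ, E) x) (x : M) : ℝ :=
  (d% (fun y ↦ ⟪Y y, Z y⟫) x (X x) + d% (fun y ↦ ⟪Z y, X y⟫) x (Y x)
    - d% (fun y ↦ ⟪X y, Y y⟫) x (Z x)
    - ⟪X x, mlieBracket 𝓘(ℝ, E) Y Z x⟫ + ⟪Y x, mlieBracket 𝓘(ℝ, E) Z X x⟫
    + ⟪Z x, mlieBracket 𝓘(ℝ, E) X Y x⟫) / 2

theorem mdiffAt_inner {x : M} {Y Z : Π x : M, TangentSpace 𝓘(ℝ, E) x}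
    (hY : MDiffAt (T% Y) x) (hZ : MDiffAt (T% Z) x) : MDiffAt (fun y ↦ ⟪Y y, Z y⟫) x :=
  MDifferentiableAt.inner_bundle (E := fun x : M ↦ TangentSpace 𝓘(ℝ, E) x)
    (b := fun x : M ↦ x) hY hZ

variable [FiniteDimensional ℝ E]

theorem koszul_tensorial₁ {x : M} (Y Z : Π x : M, TangentSpace 𝓘(ℝ, E) x)
    (hY : MDiffAt (T% Y) x) (hZ : MDiffAt (T% Z) x) :
    TensorialAt 𝓘(ℝ, E) E (fun X ↦ koszul X Y Z x) x where
  smul {f X} hf hX := by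
    have h1 : MDiffAt (fun y ↦ ⟪Z y, X y⟫) x := mdiffAt_inner hZ hX
    have h2 : MDiffAt (fun y ↦ ⟪X y, Y y⟫) x := mdiffAt_inner hX hY
    simp [koszul, mlieBracket_smul_left hf hX, mlieBracket_smul_right hf hX, inner_add_right,
      inner_smul_right, inner_smul_left, mvfderiv_fun_mul hf h1, mvfderiv_fun_mul hf h2]
    rw [real_inner_comm (Y x) (X x)]
    ring
  add {X X'} hX hX' := by
    have h1 : MDiffAt (fun y ↦ ⟪Z y, X y⟫) x := mdiffAt_inner hZ hX
    have h2 : MDiffAt (fun y ↦ ⟪X y, Y y⟫) x := mdiffAt_inner hX hY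
    have h1' : MDiffAt (fun y ↦ ⟪Z y, X' y⟫) x := mdiffAt_inner hZ hX'
    have h2' : MDiffAt (fun y ↦ ⟪X' y, Y y⟫) x := mdiffAt_inner hX' hY
    simp [koszul, mlieBracket_add_left hX hX', mlieBracket_add_right hX hX', inner_add_right,
      inner_add_left, mvfderiv_fun_add h1 h1', mvfderiv_fun_add h2 h2']
    ring

theorem koszul_tensorial₃ {x : M} (X Y : Π x : M, TangentSpace 𝓘(ℝ, E) x)
    (hX : MDiffAt (T% X) x) (hY : MDiffAt (T% Y) x) :
    TensorialAt 𝓘(ℝ, E) E (fun Z ↦ koszul X Y Z x) x where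
  smul {f Z} hf hZ := by
    have h1 : MDiffAt (fun y ↦ ⟪Y y, Z y⟫) x := mdiffAt_inner hY hZ
    have h2 : MDiffAt (fun y ↦ ⟪Z y, X y⟫) x := mdiffAt_inner hZ hX
    simp [koszul, mlieBracket_smul_left hf hZ, mlieBracket_smul_right hf hZ, inner_add_right,
      inner_smul_right, inner_smul_left, mvfderiv_fun_mul hf h1, mvfderiv_fun_mul hf h2]
    rw [real_inner_comm (X x) (Z x)]
    ring
  add {Z Z'} hZ hZ' := by
    have h1 : MDiffAt (fun y ↦ ⟪Y y, Z y⟫) x := mdiffAt_inner hY hZ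
    have h2 : MDiffAt (fun y ↦ ⟪Z y, X y⟫) x := mdiffAt_inner hZ hX
    have h1' : MDiffAt (fun y ↦ ⟪Y y, Z' y⟫) x := mdiffAt_inner hY hZ'
    have h2' : MDiffAt (fun y ↦ ⟪Z' y, X y⟫) x := mdiffAt_inner hZ' hX
    simp [koszul, mlieBracket_add_left hZ hZ', mlieBracket_add_right hZ hZ', inner_add_right,
      inner_add_left, mvfderiv_fun_add h1 h1', mvfderiv_fun_add h2 h2']
    ring

theorem koszul_add {x : M} (X Y Y' Z : Π x : M, TangentSpace 𝓘(ℝ, E) x)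
    (hX : MDiffAt (T% X) x) (hY : MDiffAt (T% Y) x) (hY' : MDiffAt (T% Y') x)
    (hZ : MDiffAt (T% Z) x) :
    koszul X (Y + Y') Z x = koszul X Y Z x + koszul X Y' Z x := by
  have h1 : MDiffAt (fun y ↦ ⟪Y y, Z y⟫) x := mdiffAt_inner hY hZ
  have h2 : MDiffAt (fun y ↦ ⟪X y, Y y⟫) x := mdiffAt_inner hX hY
  have h1' : MDiffAt (fun y ↦ ⟪Y' y, Z y⟫) x := mdiffAt_inner hY' hZ
  have h2' : MDiffAt (fun y ↦ ⟪X y, Y' y⟫) x := mdiffAt_inner hX hY'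
  simp [koszul, mlieBracket_add_left hY hY', mlieBracket_add_right hY hY', inner_add_right,
    inner_add_left, mvfderiv_fun_add h1 h1', mvfderiv_fun_add h2 h2']
  ring

theorem koszul_leibniz {x : M} {f : M → ℝ} (X Y Z : Π x : M, TangentSpace 𝓘(ℝ, E) x)
    (hf : MDiffAt f x) (hX : MDiffAt (T% X) x) (hY : MDiffAt (T% Y) x)
    (hZ : MDiffAt (T% Z) x) :
    koszul X (f • Y) Z x = f x * koszul X Y Z x + d% f x (X x) * ⟪Y x, Z x⟫ := by
  have h1 : MDiffAt (fun y ↦ ⟪Y y, Z y⟫) x := mdiffAt_inner hY hZ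
  have h2 : MDiffAt (fun y ↦ ⟪X y, Y y⟫) x := mdiffAt_inner hX hY
  simp [koszul, mlieBracket_smul_left hf hY, mlieBracket_smul_right hf hY, inner_add_right,
    inner_smul_right, inner_smul_left, mvfderiv_fun_mul hf h1, mvfderiv_fun_mul hf h2]
  rw [real_inner_comm (Y x) (Z x)]
  ring

/-- The covector-valued one-form `X ↦ g(∇_X Y, ·)` at a point where `Y` is differentiable. -/
def koszulForm (Y : Π x : M, TangentSpace 𝓘(ℝ, E) x) (x : M) (hY : MDiffAt (T% Y) x) :
    TangentSpace 𝓘(ℝ, E) x →L[ℝ] TangentSpace 𝓘(ℝ, E) x →L[ℝ] ℝ :=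
  TensorialAt.mkHom₂ (V := fun x : M ↦ TangentSpace 𝓘(ℝ, E) x)
    (V' := fun x : M ↦ TangentSpace 𝓘(ℝ, E) x) (fun X Z ↦ koszul X Y Z x) x
    (fun Z hZ ↦ koszul_tensorial₁ Y Z hY hZ) (fun X hX ↦ koszul_tensorial₃ X Y hX hY)

instance (x : M) : FiniteDimensional ℝ (TangentSpace 𝓘(ℝ, E) x) :=
  inferInstanceAs (FiniteDimensional ℝ E)

open Classical in
/-- The Levi-Civita covariant derivative `∇Y` at `x`, given by the Koszul formula
(with value `0` where `Y` is not differentiable). -/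
def leviCivitaFun (Y : Π x : M, TangentSpace 𝓘(ℝ, E) x) (x : M) :
    TangentSpace 𝓘(ℝ, E) x →L[ℝ] TangentSpace 𝓘(ℝ, E) x :=
  if hY : MDiffAt (T% Y) x then
    LinearMap.toContinuousLinearMap
      { toFun := fun u ↦
          (InnerProductSpace.toDual ℝ (TangentSpace 𝓘(ℝ, E) x)).symm (koszulForm Y x hY u)
        map_add' := fun u v ↦ by simp
        map_smul' := fun c u ↦ by simp }
  else 0

theorem inner_leviCivitaFun {x : M} {X Y Z : Π x : M, TangentSpace 𝓘(ℝ, E) x}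
    (hX : MDiffAt (T% X) x) (hY : MDiffAt (T% Y) x) (hZ : MDiffAt (T% Z) x) :
    ⟪leviCivitaFun Y x (X x), Z x⟫ = koszul X Y Z x := by
  have h := TensorialAt.mkHom₂_apply (V := fun x : M ↦ TangentSpace 𝓘(ℝ, E) x)
    (V' := fun x : M ↦ TangentSpace 𝓘(ℝ, E) x) (Φ := fun X Z ↦ koszul X Y Z x) (x := x)
    (fun Z hZ ↦ koszul_tensorial₁ Y Z hY hZ) (fun X hX ↦ koszul_tensorial₃ X Y hX hY) hX hZ
  simp only [leviCivitaFun, hY, dif_pos]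
  rw [← h]
  exact InnerProductSpace.toDual_symm_apply (𝕜 := ℝ) (E := TangentSpace 𝓘(ℝ, E) x)

/-- The Levi-Civita connection of the Riemannian metric. -/
def leviCivita : CovariantDerivative 𝓘(ℝ, E) E (fun x : M ↦ TangentSpace 𝓘(ℝ, E) x) where
  toFun := leviCivitaFun
  isCovariantDerivativeOnUniv :=
    { add := by
        intro Y Y' x hY hY' _
        ext1 u
        refine ext_inner_right ℝ fun w ↦ ?_
        have hu := mdifferentiableAt_extend 𝓘(ℝ, E) E u
        have hw := mdifferentiableAt_extend 𝓘(ℝ, E) E w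
        have h := koszul_add (extend E u) Y Y' (extend E w) hu hY hY' hw
        rw [← inner_leviCivitaFun hu (mdifferentiableAt_add_section hY hY') hw,
          ← inner_leviCivitaFun hu hY hw, ← inner_leviCivitaFun hu hY' hw] at h
        simpa [inner_add_left] using h
      leibniz := by
        intro Y f x hY hf _
        ext1 u
        refine ext_inner_right ℝ fun w ↦ ?_
        have hu := mdifferentiableAt_extend 𝓘(ℝ, E) E u
        have hw := mdifferentiableAt_extend 𝓘(ℝ, E) E w
        have h := koszul_leibniz (extend E u) Y (extend E w) hf hu hY hw
        rw [← inner_leviCivitaFun hu (hf.smul_section hY) hw,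
          ← inner_leviCivitaFun hu hY hw] at h
        simpa [inner_add_left, inner_smul_left] using h }

theorem leviCivita_metric {x : M} {X Y Z : Π x : M, TangentSpace 𝓘(ℝ, E) x}
    (hX : MDiffAt (T% X) x) (hY : MDiffAt (T% Y) x) (hZ : MDiffAt (T% Z) x) :
    d% (fun y ↦ ⟪Y y, Z y⟫) x (X x)
      = ⟪leviCivita Y x (X x), Z x⟫ + ⟪Y x, leviCivita Z x (X x)⟫ := by
  have h1 := inner_leviCivitaFun hX hY hZ
  have h2 := inner_leviCivitaFun hX hZ hY
  rw [real_inner_comm] at h2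
  change _ = ⟪leviCivitaFun Y x (X x), Z x⟫ + ⟪Y x, leviCivitaFun Z x (X x)⟫
  rw [h1, h2]
  have e1 : (fun y ↦ ⟪Z y, Y y⟫) = fun y ↦ ⟪Y y, Z y⟫ := funext fun y ↦ real_inner_comm _ _
  have e2 : (fun y ↦ ⟪Z y, X y⟫) = fun y ↦ ⟪X y, Z y⟫ := funext fun y ↦ real_inner_comm _ _
  have e3 : (fun y ↦ ⟪Y y, X y⟫) = fun y ↦ ⟪X y, Y y⟫ := funext fun y ↦ real_inner_comm _ _
  simp only [koszul, e1, e2, e3, mlieBracket_swap_apply (V := Z) (W := Y),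
    mlieBracket_swap_apply (V := Z) (W := X), mlieBracket_swap_apply (V := Y) (W := X),
    inner_neg_right]
  ring

theorem leviCivita_torsion {x : M} {X Y : Π x : M, TangentSpace 𝓘(ℝ, E) x}
    (hX : MDiffAt (T% X) x) (hY : MDiffAt (T% Y) x) :
    leviCivita Y x (X x) - leviCivita X x (Y x) = mlieBracket 𝓘(ℝ, E) X Y x := by
  refine ext_inner_right ℝ fun w ↦ ?_
  have hw := mdifferentiableAt_extend 𝓘(ℝ, E) E w
  have h1 := inner_leviCivitaFun hX hY hw
  have h2 := inner_leviCivitaFun hY hX hw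
  rw [extend_apply_self] at h1 h2
  rw [inner_sub_left]
  change ⟪leviCivitaFun Y x (X x), w⟫ - ⟪leviCivitaFun X x (Y x), w⟫ = _
  rw [h1, h2, real_inner_comm]
  have e1 : (fun y ↦ ⟪extend E w y, X y⟫) = fun y ↦ ⟪X y, extend E w y⟫ :=
    funext fun y ↦ real_inner_comm _ _
  have e2 : (fun y ↦ ⟪extend E w y, Y y⟫) = fun y ↦ ⟪Y y, extend E w y⟫ :=
    funext fun y ↦ real_inner_comm _ _
  have e3 : (fun y ↦ ⟪Y y, X y⟫) = fun y ↦ ⟪X y, Y y⟫ := funext fun y ↦ real_inner_comm _ _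
  simp only [koszul, e1, e2, e3, mlieBracket_swap_apply (V := extend E w) (W := Y),
    mlieBracket_swap_apply (V := extend E w) (W := X), mlieBracket_swap_apply (V := Y) (W := X),
    inner_neg_right, extend_apply_self]
  ring

/-- The curvature `R(X,Y)Z = ∇_X ∇_Y Z - ∇_Y ∇_X Z - ∇_[X,Y] Z` of the Levi-Civita connection. -/
def curvature (X Y Z : Π x : M, TangentSpace 𝓘(ℝ, E) x) (x : M) : TangentSpace 𝓘(ℝ, E) x :=
  leviCivita (fun y ↦ leviCivita Z y (Y y)) x (X x)
    - leviCivita (fun y ↦ leviCivita Z y (X y)) x (Y x)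
    - leviCivita Z x (mlieBracket 𝓘(ℝ, E) X Y x)

/-- The Ricci tensor `S(u,v) = trace (w ↦ R(w,u)v)`, as a sum over an orthonormal basis of the
tangent space. Tangent vectors at `x` are extended to vector fields that are smooth near `x`; the
curvature at `x` does not depend on the extension. -/
def ricci (x : M) (u v : TangentSpace 𝓘(ℝ, E) x) : ℝ :=
  ∑ i, ⟪curvature (extend E (stdOrthonormalBasis ℝ (TangentSpace 𝓘(ℝ, E) x) i))
    (extend E u) (extend E v) x, stdOrthonormalBasis ℝ (TangentSpace 𝓘(ℝ, E) x) i⟫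

/-- The scalar curvature: the metric trace of the Ricci tensor. -/
def scalarCurvature (x : M) : ℝ :=
  ∑ i, ricci x (stdOrthonormalBasis ℝ (TangentSpace 𝓘(ℝ, E) x) i)
    (stdOrthonormalBasis ℝ (TangentSpace 𝓘(ℝ, E) x) i)

/-- The Lie derivative of the metric,
`(L_V g)(X,Y) = V(g(X,Y)) - g([V,X],Y) - g(X,[V,Y])`. -/
def lieDerivMetric (V X Y : Π x : M, TangentSpace 𝓘(ℝ, E) x) (x : M) : ℝ :=
  d% (fun y ↦ ⟪X y, Y y⟫) x (V x) - ⟪mlieBracket 𝓘(ℝ, E) V X x, Y x⟫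
    - ⟪X x, mlieBracket 𝓘(ℝ, E) V Y x⟫

/-- `(φ, ξ, η)` is an almost contact metric structure for the given Riemannian metric. The one-form
`η` is smooth because it is metrically dual to the smooth vector field `ξ`. -/
structure IsAlmostContactMetric
    (φ : Π x : M, TangentSpace 𝓘(ℝ, E) x →L[ℝ] TangentSpace 𝓘(ℝ, E) x)
    (ξ : Π x : M, TangentSpace 𝓘(ℝ, E) x) (η : Π x : M, TangentSpace 𝓘(ℝ, E) x →L[ℝ] ℝ) :
    Prop where
  smooth_phi : ContMDiff 𝓘(ℝ, E) (𝓘(ℝ, E).prod 𝓘(ℝ, E →L[ℝ] E)) ∞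
    (fun x ↦ TotalSpace.mk' (E →L[ℝ] E)
      (E := fun x : M ↦ TangentSpace 𝓘(ℝ, E) x →L[ℝ] TangentSpace 𝓘(ℝ, E) x) x (φ x))
  smooth_xi : CMDiff ∞ (T% ξ)
  phi_phi : ∀ (x : M) (u : TangentSpace 𝓘(ℝ, E) x), φ x (φ x u) = -u + η x u • ξ x
  eta_xi : ∀ x : M, η x (ξ x) = 1
  eta_eq : ∀ (x : M) (u : TangentSpace 𝓘(ℝ, E) x), η x u = ⟪u, ξ x⟫
  inner_phi_phi : ∀ (x : M) (u v : TangentSpace 𝓘(ℝ, E) x),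
    ⟪φ x u, φ x v⟫ = ⟪u, v⟫ - η x u * η x v
  inner_phi : ∀ (x : M) (u v : TangentSpace 𝓘(ℝ, E) x), ⟪u, φ x v⟫ + ⟪v, φ x u⟫ = 0

/-- The almost contact metric structure `(φ, ξ, η)` is trans-Sasakian of type `(α, β)`:
`α`, `β` are smooth functions and
`(∇_X φ)Y = α (g(X,Y) ξ - η(Y) X) + β (g(φX,Y) ξ - η(Y) φX)`,
where `(∇_X φ)Y = ∇_X (φY) - φ(∇_X Y)`. -/
structure IsTransSasakian
    (φ : Π x : M, TangentSpace 𝓘(ℝ, E) x →L[ℝ] TangentSpace 𝓘(ℝ, E) x)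
    (ξ : Π x : M, TangentSpace 𝓘(ℝ, E) x) (η : Π x : M, TangentSpace 𝓘(ℝ, E) x →L[ℝ] ℝ)
    (α β : M → ℝ) : Prop extends IsAlmostContactMetric φ ξ η where
  smooth_alpha : CMDiff ∞ α
  smooth_beta : CMDiff ∞ β
  nabla_phi : ∀ (x : M) (X Y : Π x : M, TangentSpace 𝓘(ℝ, E) x),
    CMDiffAt ∞ (T% X) x → CMDiffAt ∞ (T% Y) x →
    leviCivita (fun y ↦ φ y (Y y)) x (X x) - φ x (leviCivita Y x (X x))
      = α x • (⟪X x, Y x⟫ • ξ x - η x (Y x) • X x)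
        + β x • (⟪φ x (X x), Y x⟫ • ξ x - η x (Y x) • φ x (X x))

/-- `(g, ξ, lam, μ)` is an `η`-Einstein soliton:
`L_ξ g + 2 S + (2 lam - r) g + 2 μ η ⊗ η = 0`. -/
def IsEtaEinsteinSoliton (ξ : Π x : M, TangentSpace 𝓘(ℝ, E) x)
    (η : Π x : M, TangentSpace 𝓘(ℝ, E) x →L[ℝ] ℝ) (lam μ : ℝ) : Prop :=
  ∀ (x : M) (X Y : Π x : M, TangentSpace 𝓘(ℝ, E) x),
    CMDiffAt ∞ (T% X) x → CMDiffAt ∞ (T% Y) x →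
    lieDerivMetric ξ X Y x + 2 * ricci x (X x) (Y x)
      + (2 * lam - scalarCurvature (E := E) x) * ⟪X x, Y x⟫
      + 2 * μ * (η x (X x) * η x (Y x)) = 0

/-- The curvature condition `R(ξ,X)·S = 0`:
`S(R(ξ,X)Y, Z) + S(Y, R(ξ,X)Z) = 0` for all `X`, `Y`, `Z`. -/
def RicciSemisymmetricAlong (ξ : Π x : M, TangentSpace 𝓘(ℝ, E) x) : Prop :=
  ∀ (x : M) (X Y Z : Π x : M, TangentSpace 𝓘(ℝ, E) x),
    CMDiffAt ∞ (T% X) x → CMDiffAt ∞ (T% Y) x → CMDiffAt ∞ (T% Z) x →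
    ricci x (curvature ξ X Y x) (Z x) + ricci x (Y x) (curvature ξ X Z x) = 0

variable (E M) in
/-- The metric is Einstein: `S = c g` for a constant `c`. -/
def IsEinstein : Prop :=
  ∃ c : ℝ, ∀ (x : M) (u v : TangentSpace 𝓘(ℝ, E) x), ricci x u v = c * ⟪u, v⟫

end RiemGeom

end

open Bundle VectorField FiberBundle
open scoped Manifold ContDiff Topology

noncomputable section

namespace RiemGeom

/-! ### Differentiability of determinants and adjugates. -/

section Matrix

/-! Putting Y = ξ in the structure equation gives ∇_u ξ = -αφu + β(u - η(u)ξ). Its α part is skew,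
so L_ξ g = 2β(g - η⊗η), and the soliton equation becomes S = (r/2 - λ - β) g + (β - μ) η⊗η
(`IsEtaEinsteinSoliton.ricci_eq`). Tracing in dimension 3 gives r = 6λ + 4β + 2μ, hence S(ξ,ξ) = 2(λ
+ β). Differentiating ∇ξ once more computes R(·,ξ)ξ, whose trace is S(ξ,ξ) = 2(α² - β² - ξβ)
(`IsTransSasakian.ricci_xi_xi`). Thus α² - β² - ξβ = λ + β.

In R(ξ,X)·S = 0 the g part of S drops out by skew-symmetry of the curvature, while the η⊗η part
leaves (β - μ)(α² - β² - ξβ) = 0 (`RicciSemisymmetricAlong.mul_eq_zero`), that is, (β - μ)(β + λ) =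
0 pointwise. So β takes at most two values and is constant on each component. If that constant is
not μ, then β = -λ and ξβ = 0 there, which forces α² = β² on the whole component, against the
hypothesis. With β = μ the formulas for S and r are the conclusion.

The Ricci tensor is defined through extensions of tangent vectors, so replacing an extension of ξ(x)
by ξ needs the curvature to be pointwise (`curvature_congr`). This is deduced from the algebraic
curvature symmetries. -/

theorem differentiable_det {ι : Type*} [Fintype ι] [DecidableEq ι] :
    Differentiable ℝ (fun A : ι → ι → ℝ ↦ (Matrix.of A).det) := by
  simp only [Matrix.det_apply, Matrix.of_apply]
  fun_prop

/-- An adjugate entry is a determinant with one row replaced by a basis vector. This serves Cramer's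
rule for Gram matrices. -/
theorem differentiable_adjugate {ι : Type*} [Fintype ι] [DecidableEq ι] (i j : ι) :
    Differentiable ℝ (fun A : ι → ι → ℝ ↦ (Matrix.of A).adjugate i j) := by
  have h : Differentiable ℝ (fun A : ι → ι → ℝ ↦ Function.update A j (Pi.single i 1)) := by
    refine differentiable_pi.2 fun k ↦ ?_
    by_cases hk : k = j
    · subst hk
      simp
    · simp only [Function.update_of_ne hk]
      fun_prop
  simpa only [Matrix.adjugate_apply] using! differentiable_det.comp h

end Matrix

/-! ### Regularity of brackets and of ∇, and the commutator formula for derivatives of functions. -/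

section Riemannian

variable {E : Type*} [NormedAddCommGroup E] [NormedSpace ℝ E]
  {M : Type*} [TopologicalSpace M] [ChartedSpace E M] [IsManifold 𝓘(ℝ, E) ∞ M]

theorem eventually_mdiffAt {x : M} {X : Π x : M, TangentSpace 𝓘(ℝ, E) x}
    (hX : CMDiffAt 2 (T% X) x) : ∀ᶠ y in 𝓝 x, MDiffAt (T% X) y :=
  ((contMDiffAt_iff_contMDiffAt_nhds (by simp)).1 hX).mono fun _ h ↦
    h.mdifferentiableAt two_ne_zero

theorem eventually_mdiffAt_fun {x : M} {f : M → ℝ}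
    (hf : CMDiffAt 2 f x) : ∀ᶠ y in 𝓝 x, MDiffAt f y :=
  ((contMDiffAt_iff_contMDiffAt_nhds (by simp)).1 hf).mono fun _ h ↦
    h.mdifferentiableAt two_ne_zero

theorem mdiffAt_mlieBracket [FiniteDimensional ℝ E] {x : M} {X Y : Π x : M, TangentSpace 𝓘(ℝ, E) x}
    (hX : CMDiffAt 2 (T% X) x) (hY : CMDiffAt 2 (T% Y) x) :
    MDiffAt (T% (mlieBracket 𝓘(ℝ, E) X Y)) x := by
  have : IsManifold 𝓘(ℝ, E) ((2 : ℕ∞) + 1) M := IsManifold.of_le (n := ∞) (by norm_cast)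
  have : IsManifold 𝓘(ℝ, E) (minSmoothness ℝ 2) M := by
    rw [minSmoothness_of_isRCLikeNormedField]; infer_instance
  exact (ContMDiffAt.mlieBracket_vectorField (m := 1) (n := 2) hX hY
    (by simp; norm_num)).mdifferentiableAt one_ne_zero

variable [RiemannianBundle (fun x : M ↦ TangentSpace 𝓘(ℝ, E) x)]
  [IsContMDiffRiemannianBundle 𝓘(ℝ, E) ∞ E (fun x : M ↦ TangentSpace 𝓘(ℝ, E) x)]

local notation "⟪" v ", " w "⟫" => inner ℝ v w

theorem contMDiffAt_inner {n : ℕ∞ω} [ENat.LEInfty n] {x : M}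
    {Y Z : Π x : M, TangentSpace 𝓘(ℝ, E) x}
    (hY : CMDiffAt n (T% Y) x) (hZ : CMDiffAt n (T% Z) x) : CMDiffAt n (fun y ↦ ⟪Y y, Z y⟫) x :=
  ContMDiffAt.inner_bundle (E := fun x : M ↦ TangentSpace 𝓘(ℝ, E) x) (b := fun x : M ↦ x) hY hZ

variable [FiniteDimensional ℝ E]

/-- A vector field is differentiable at `x` if its inner products with all smooth vector fields
are. -/
theorem mdiffAt_of_inner {x : M} {V : Π x : M, TangentSpace 𝓘(ℝ, E) x}
    (hV : ∀ W : Π x : M, TangentSpace 𝓘(ℝ, E) x, CMDiffAt ∞ (T% W) x →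
      MDiffAt (fun y ↦ ⟪V y, W y⟫) x) : MDiffAt (T% V) x := by
  classical
  let e := trivializationAt E (TangentSpace 𝓘(ℝ, E) : M → Type _) x
  have hxe : x ∈ e.baseSet := FiberBundle.mem_baseSet_trivializationAt' x
  let b := Module.finBasis ℝ E
  have hs := e.isLocalFrameOn_localFrame_baseSet 𝓘(ℝ, E) 1 b
  have hs' := e.isLocalFrameOn_localFrame_baseSet 𝓘(ℝ, E) ∞ b
  set s := e.localFrame b
  have hsm : ∀ i, CMDiffAt ∞ (T% (s i)) x := fun i ↦ hs'.contMDiffAt e.open_baseSet hxe i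
  let G : M → Fin (Module.finrank ℝ E) → Fin (Module.finrank ℝ E) → ℝ :=
    fun y i j ↦ ⟪s i y, s j y⟫
  have hG : MDifferentiableAt 𝓘(ℝ, E)
      𝓘(ℝ, Fin (Module.finrank ℝ E) → Fin (Module.finrank ℝ E) → ℝ) G x := by
    refine ContMDiffAt.mdifferentiableAt (n := 1) ?_ one_ne_zero
    exact contMDiffAt_pi_space.2 fun i ↦ contMDiffAt_pi_space.2 fun j ↦
      contMDiffAt_inner ((hsm i).of_le ENat.LEInfty.out) ((hsm j).of_le ENat.LEInfty.out)
  have hdet : ∀ y ∈ e.baseSet, (Matrix.of (G y)).det ≠ 0 := fun y hy ↦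
    (Matrix.posDef_gram_of_linearIndependent (𝕜 := ℝ) (hs.linearIndependent hy)).det_pos.ne'
  refine hs.mdifferentiableAt_of_coeff (fun i ↦ ?_) (e.open_baseSet.mem_nhds hxe)
  -- Cramer's rule: the Gram matrix sends the frame coefficients of V to its inner products with the
  -- frame.
  have hcoeff : ∀ᶠ y in 𝓝 x, hs.coeff i y (V y)
      = (Matrix.of (G y)).det⁻¹ * ∑ j, (Matrix.of (G y)).adjugate i j * ⟪V y, s j y⟫ := by
    filter_upwards [e.open_baseSet.mem_nhds hxe] with y hy
    have hh : (fun j ↦ ⟪V y, s j y⟫) = (Matrix.of (G y)).mulVec fun k ↦ hs.coeff k y (V y) := by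
      funext j
      conv_lhs => rw [hs.coeff_sum_eq V hy]
      simp only [sum_inner, inner_smul_left, Matrix.mulVec, dotProduct, Matrix.of_apply, G]
      exact Finset.sum_congr rfl fun k _ ↦ by rw [real_inner_comm, mul_comm]; rfl
    have h2 := congrFun (congrArg (Matrix.of (G y)).adjugate.mulVec hh) i
    rw [Matrix.mulVec_mulVec, Matrix.adjugate_mul, Matrix.smul_mulVec, Matrix.one_mulVec] at h2
    rw [eq_inv_mul_iff_mul_eq₀ (hdet y hy)]
    exact h2.symm
  refine MDifferentiableAt.congr_of_eventuallyEq ?_ hcoeff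
  have h1 : MDiffAt (fun y ↦ (Matrix.of (G y)).det) x :=
    (differentiable_det (G x)).mdifferentiableAt.comp x hG
  have h2 : ∀ j, MDiffAt (fun y ↦ (Matrix.of (G y)).adjugate i j) x := fun j ↦
    (differentiable_adjugate i j (G x)).mdifferentiableAt.comp x hG
  have h3 : MDiffAt (fun y ↦ (Matrix.of (G y)).det⁻¹) x :=
    (differentiableAt_inv (hdet x hxe)).mdifferentiableAt.comp x h1
  refine h3.mul ?_
  have h4 := MDifferentiableAt.sum (t := Finset.univ) fun j _ ↦ (h2 j).mul (hV _ (hsm j))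
  rwa [Finset.sum_fn] at h4

/-- The derivative of a function along a vector field is differentiable. -/
theorem mdiffAt_mvfderiv_apply {x : M} {f : M → ℝ} {X : Π x : M, TangentSpace 𝓘(ℝ, E) x}
    (hf : CMDiffAt 2 f x) (hX : CMDiffAt 2 (T% X) x) : MDiffAt (fun y ↦ d% f y (X y)) x := by
  -- A nonvanishing local field Z is needed below; in dimension 0 every derivative is zero.
  refine Or.elim (subsingleton_or_nontrivial E) (fun _ ↦ ?_) (fun _ ↦ ?_)
  · have h0 : (fun y ↦ d% f y (X y)) = fun _ ↦ 0 := by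
      funext y
      have : X y = 0 := Subsingleton.elim (α := E) _ _
      rw [this, map_zero]
    rw [h0]
    exact mdifferentiableAt_const
  obtain ⟨z, hz⟩ : ∃ z : TangentSpace 𝓘(ℝ, E) x, z ≠ 0 := exists_ne (α := E) 0
  set Z := extend E z
  have hZ : CMDiffAt 2 (T% Z) x := contMDiffAt_extend _ _ _
  have hZx : Z x = z := extend_apply_self _ _
  have hn : MDiffAt (fun y ↦ ⟪Z y, Z y⟫) x :=
    mdiffAt_inner (hZ.mdifferentiableAt two_ne_zero) (hZ.mdifferentiableAt two_ne_zero)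
  have hn0 : ⟪Z x, Z x⟫ ≠ 0 := by rwa [hZx, Ne, inner_self_eq_zero]
  have h1 : MDiffAt (fun y ↦ ⟪mlieBracket 𝓘(ℝ, E) X (f • Z) y, Z y⟫) x :=
    mdiffAt_inner (mdiffAt_mlieBracket hX (hf.smul_section hZ)) (hZ.mdifferentiableAt two_ne_zero)
  have h2 : MDiffAt (fun y ↦ ⟪mlieBracket 𝓘(ℝ, E) X Z y, Z y⟫) x :=
    mdiffAt_inner (mdiffAt_mlieBracket hX hZ) (hZ.mdifferentiableAt two_ne_zero)
  have h3 : MDiffAt (fun y ↦ ⟪Z y, Z y⟫⁻¹) x :=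
    (differentiableAt_inv hn0).mdifferentiableAt.comp x hn
  -- Pairing [X, fZ] = X(f) Z + f [X, Z] with Z and dividing by |Z|² isolates X(f).
  refine ((h1.sub ((hf.mdifferentiableAt two_ne_zero).mul h2)).mul h3).congr_of_eventuallyEq ?_
  filter_upwards [eventually_mdiffAt_fun hf, eventually_mdiffAt hZ,
    hn.continuousAt.eventually_ne hn0] with y hfy hZy hy
  rw [Pi.mul_apply, Pi.sub_apply, Pi.mul_apply,
    mlieBracket_smul_right (hfy) (hZy),
    inner_add_left, inner_smul_left, inner_smul_left]
  simp only [conj_trivial]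
  field_simp
  ring

/-- The Levi-Civita connection takes `C²` vector fields to differentiable ones. -/
theorem mdiffAt_leviCivita {x : M} {X Z : Π x : M, TangentSpace 𝓘(ℝ, E) x}
    (hX : CMDiffAt 2 (T% X) x) (hZ : CMDiffAt 2 (T% Z) x) :
    MDiffAt (T% (fun y ↦ leviCivita Z y (X y))) x := by
  refine mdiffAt_of_inner fun W hW ↦ ?_
  replace hW : CMDiffAt 2 (T% W) x := hW.of_le ENat.LEInfty.out
  have dX := hX.mdifferentiableAt two_ne_zero
  have dZ := hZ.mdifferentiableAt two_ne_zero
  have dW := hW.mdifferentiableAt two_ne_zero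
  -- The Koszul formula involves only first derivatives and brackets of C² data.
  have h : MDiffAt (fun y ↦ koszul X Z W y) x := by
    have h1 := mdiffAt_mvfderiv_apply (contMDiffAt_inner hZ hW) hX
    have h2 := mdiffAt_mvfderiv_apply (contMDiffAt_inner hW hX) hZ
    have h3 := mdiffAt_mvfderiv_apply (contMDiffAt_inner hX hZ) hW
    have h4 := mdiffAt_inner dX (mdiffAt_mlieBracket hZ hW)
    have h5 := mdiffAt_inner dZ (mdiffAt_mlieBracket hW hX)
    have h6 := mdiffAt_inner dW (mdiffAt_mlieBracket hX hZ)
    simp only [koszul, div_eq_mul_inv]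
    exact (((((h1.add h2).sub h3).sub h4).add h5).add h6).mul mdifferentiableAt_const
  refine h.congr_of_eventuallyEq ?_
  filter_upwards [eventually_mdiffAt hX, eventually_mdiffAt hZ, eventually_mdiffAt hW]
    with y hXy hZy hWy
  exact inner_leviCivitaFun (hXy) (hZy)
    (hWy)

/-- The Lie bracket acts on functions as the commutator. -/
theorem mvfderiv_mlieBracket {x : M} {f : M → ℝ} {X Y : Π x : M, TangentSpace 𝓘(ℝ, E) x}
    (hf : CMDiffAt 2 f x) (hX : CMDiffAt 2 (T% X) x) (hY : CMDiffAt 2 (T% Y) x) :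
    d% f x (mlieBracket 𝓘(ℝ, E) X Y x)
      = d% (fun y ↦ d% f y (Y y)) x (X x) - d% (fun y ↦ d% f y (X y)) x (Y x) := by
  refine Or.elim (subsingleton_or_nontrivial E) (fun _ ↦ ?_) (fun _ ↦ ?_)
  · have h0 : ∀ v : TangentSpace 𝓘(ℝ, E) x, v = 0 := fun v ↦ Subsingleton.elim (α := E) _ _
    rw [h0 (X x), h0 (Y x), h0 (mlieBracket 𝓘(ℝ, E) X Y x)]
    simp
  obtain ⟨z, hz⟩ : ∃ z : TangentSpace 𝓘(ℝ, E) x, z ≠ 0 := exists_ne (α := E) 0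
  set Z := extend E z
  have hZ : CMDiffAt 2 (T% Z) x := contMDiffAt_extend _ _ _
  have hZx : Z x = z := extend_apply_self _ _
  have df := hf.mdifferentiableAt two_ne_zero
  have dZ := hZ.mdifferentiableAt two_ne_zero
  have key : ∀ {U V : Π x : M, TangentSpace 𝓘(ℝ, E) x}, CMDiffAt 2 (T% U) x →
      CMDiffAt 2 (T% V) x → mlieBracket 𝓘(ℝ, E) U (mlieBracket 𝓘(ℝ, E) V (f • Z)) x
        = d% (fun y ↦ d% f y (V y)) x (U x) • Z x + d% f x (V x) • mlieBracket 𝓘(ℝ, E) U Z x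
          + (d% f x (U x) • mlieBracket 𝓘(ℝ, E) V Z x
            + f x • mlieBracket 𝓘(ℝ, E) U (mlieBracket 𝓘(ℝ, E) V Z) x) := by
    intro U V hU hV
    have h : mlieBracket 𝓘(ℝ, E) V (f • Z)
        =ᶠ[𝓝 x] (fun y ↦ d% f y (V y)) • Z + f • mlieBracket 𝓘(ℝ, E) V Z := by
      filter_upwards [eventually_mdiffAt_fun hf, eventually_mdiffAt hZ] with y hfy hZy
      exact mlieBracket_smul_right (hfy)
        (hZy)
    have dVf := mdiffAt_mvfderiv_apply hf hV
    have dVZ := mdiffAt_mlieBracket hV hZ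
    rw [Filter.EventuallyEq.mlieBracket_vectorField_eq (Filter.EventuallyEq.refl _ U) h,
      mlieBracket_add_right (dVf.smul_section dZ) (df.smul_section dVZ),
      mlieBracket_smul_right dVf dZ, mlieBracket_smul_right df dVZ]
  have : IsManifold 𝓘(ℝ, E) (minSmoothness ℝ 3) M := by
    rw [minSmoothness_of_isRCLikeNormedField]; exact IsManifold.of_le (n := ∞) ENat.LEInfty.out
  -- Comparing the Jacobi identities for fZ and for Z, the cross terms cancel and only ([X,Y]f - XYf
  -- + YXf) Z = 0 remains.
  have hJ := leibniz_identity_mlieBracket_apply (I := 𝓘(ℝ, E)) (x := x) (U := X) (V := Y)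
    (W := f • Z) (by simpa using hX) (by simpa using hY) (by simpa using hf.smul_section hZ)
  have hJ' := leibniz_identity_mlieBracket_apply (I := 𝓘(ℝ, E)) (x := x) (U := X) (V := Y)
    (W := Z) (by simpa using hX) (by simpa using hY) (by simpa using hZ)
  rw [key hX hY, key hY hX, mlieBracket_smul_right df dZ, hJ'] at hJ
  have h : (d% f x (mlieBracket 𝓘(ℝ, E) X Y x)
      - (d% (fun y ↦ d% f y (Y y)) x (X x) - d% (fun y ↦ d% f y (X y)) x (Y x))) • Z x = 0 := by
    rw [← sub_eq_zero] at hJ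
    rw [← neg_eq_zero, ← hJ]
    module
  rw [hZx] at h
  exact sub_eq_zero.1 ((smul_eq_zero.1 h).resolve_right hz)

end Riemannian


/-! ### Algebraic symmetries of the Riemann tensor and its pointwise nature. -/

section Curvature

variable {E : Type*} [NormedAddCommGroup E] [NormedSpace ℝ E]
  {M : Type*} [TopologicalSpace M] [ChartedSpace E M]

local notation "⟪" v ", " w "⟫" => inner ℝ v w

theorem mvfderiv_congr_of_eventuallyEq {x : M} {f g : M → ℝ} (h : f =ᶠ[𝓝 x] g)
    (v : TangentSpace 𝓘(ℝ, E) x) : d% f x v = d% g x v := by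
  simp only [mvfderiv, ContinuousLinearMap.comp_apply, h.mfderiv_eq]
  rfl

variable [IsManifold 𝓘(ℝ, E) ∞ M]
  [RiemannianBundle (fun x : M ↦ TangentSpace 𝓘(ℝ, E) x)]
  [IsContMDiffRiemannianBundle 𝓘(ℝ, E) ∞ E (fun x : M ↦ TangentSpace 𝓘(ℝ, E) x)]
  [FiniteDimensional ℝ E]

/-- The second derivative of an inner product of vector fields. -/
theorem mvfderiv_mvfderiv_inner {x : M} {X Y Z W : Π x : M, TangentSpace 𝓘(ℝ, E) x}
    (hX : CMDiffAt 2 (T% X) x) (hY : CMDiffAt 2 (T% Y) x) (hZ : CMDiffAt 2 (T% Z) x)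
    (hW : CMDiffAt 2 (T% W) x) :
    d% (fun y ↦ d% (fun y ↦ ⟪Z y, W y⟫) y (Y y)) x (X x)
      = ⟪leviCivita (fun y ↦ leviCivita Z y (Y y)) x (X x), W x⟫
        + ⟪leviCivita Z x (Y x), leviCivita W x (X x)⟫
        + ⟪leviCivita Z x (X x), leviCivita W x (Y x)⟫
        + ⟪Z x, leviCivita (fun y ↦ leviCivita W y (Y y)) x (X x)⟫ := by
  have dX := hX.mdifferentiableAt two_ne_zero
  have dZ := hZ.mdifferentiableAt two_ne_zero
  have dW := hW.mdifferentiableAt two_ne_zero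
  have dYZ := mdiffAt_leviCivita hY hZ
  have dYW := mdiffAt_leviCivita hY hW
  have h : (fun y ↦ d% (fun y ↦ ⟪Z y, W y⟫) y (Y y)) =ᶠ[𝓝 x]
      fun y ↦ ⟪leviCivita Z y (Y y), W y⟫ + ⟪Z y, leviCivita W y (Y y)⟫ := by
    filter_upwards [eventually_mdiffAt hY, eventually_mdiffAt hZ, eventually_mdiffAt hW]
      with y hYy hZy hWy using leviCivita_metric hYy hZy hWy
  rw [mvfderiv_congr_of_eventuallyEq h,
    mvfderiv_fun_add (mdiffAt_inner dYZ dW) (mdiffAt_inner dZ dYW), add_apply]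
  rw [leviCivita_metric dX dYZ dW, leviCivita_metric dX dZ dYW]
  ring

/-- The curvature is skew-symmetric in its last two arguments. -/
theorem inner_curvature_skew {x : M} {X Y Z W : Π x : M, TangentSpace 𝓘(ℝ, E) x}
    (hX : CMDiffAt 2 (T% X) x) (hY : CMDiffAt 2 (T% Y) x) (hZ : CMDiffAt 2 (T% Z) x)
    (hW : CMDiffAt 2 (T% W) x) :
    ⟪curvature X Y Z x, W x⟫ = - ⟪curvature X Y W x, Z x⟫ := by
  have h1 := mvfderiv_mvfderiv_inner hX hY hZ hW
  have h2 := mvfderiv_mvfderiv_inner hY hX hZ hW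
  -- The commutator formula is applied to f = g(Z,W); the products of first covariant derivatives
  -- are symmetric in X, Y and cancel.
  have h3 := mvfderiv_mlieBracket (contMDiffAt_inner hZ hW) hX hY
  rw [h1, h2, leviCivita_metric (mdiffAt_mlieBracket hX hY) (hZ.mdifferentiableAt two_ne_zero)
    (hW.mdifferentiableAt two_ne_zero)] at h3
  simp only [curvature, inner_sub_left]
  rw [real_inner_comm (Z x), real_inner_comm (Z x), real_inner_comm (Z x)]
  linarith

theorem curvature_swap (X Y Z : Π x : M, TangentSpace 𝓘(ℝ, E) x) (x : M) :
    curvature X Y Z x = - curvature Y X Z x := by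
  simp only [curvature, mlieBracket_swap_apply (V := X) (W := Y), map_neg]
  abel

theorem leviCivita_congr_of_eventuallyEq {x : M} {Y Z : Π x : M, TangentSpace 𝓘(ℝ, E) x}
    (hY : MDiffAt (T% Y) x) (hZ : MDiffAt (T% Z) x) (h : ∀ᶠ y in 𝓝 x, Y y = Z y) :
    leviCivita Y x = leviCivita Z x :=
  leviCivita.isCovariantDerivativeOnUniv.congr_of_eventuallyEq hY hZ Filter.univ_mem h

theorem leviCivita_sub {x : M} {Y Z : Π x : M, TangentSpace 𝓘(ℝ, E) x}
    (hY : MDiffAt (T% Y) x) (hZ : MDiffAt (T% Z) x) :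
    leviCivita (fun y ↦ Y y - Z y) x = leviCivita Y x - leviCivita Z x := by
  have hn := leviCivita.isCovariantDerivativeOnUniv.smul_const (-1 : ℝ) hZ
  have hZ' : MDiffAt (T% ((-1 : ℝ) • Z)) x :=
    (mdifferentiableAt_const (c := (-1 : ℝ))).smul_section hZ
  have := leviCivita.isCovariantDerivativeOnUniv.add hY hZ'
  have e : (fun y ↦ Y y - Z y) = Y + (-1 : ℝ) • Z := by
    funext y
    simp [sub_eq_add_neg]
  rw [e]
  refine this.trans ?_
  rw [hn]
  module

/-- Two uses of vanishing torsion. Summed cyclically, the left side regroups into the Bianchi sum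
and the right side into the Jacobi sum. -/
theorem leviCivita_commutator {x : M} {X Y Z : Π x : M, TangentSpace 𝓘(ℝ, E) x}
    (hX : CMDiffAt 2 (T% X) x) (hY : CMDiffAt 2 (T% Y) x) (hZ : CMDiffAt 2 (T% Z) x) :
    leviCivita (fun y ↦ leviCivita Z y (Y y)) x (X x)
      - leviCivita (fun y ↦ leviCivita Y y (Z y)) x (X x)
      - leviCivita X x (mlieBracket 𝓘(ℝ, E) Y Z x)
      = mlieBracket 𝓘(ℝ, E) X (mlieBracket 𝓘(ℝ, E) Y Z) x := by
  have dX := hX.mdifferentiableAt two_ne_zero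
  have dYZ := mdiffAt_mlieBracket hY hZ
  have d1 := mdiffAt_leviCivita hY hZ
  have d2 := mdiffAt_leviCivita hZ hY
  rw [← leviCivita_torsion dX dYZ]
  congr 1
  have h : leviCivita (mlieBracket 𝓘(ℝ, E) Y Z) x
      = leviCivita (fun y ↦ leviCivita Z y (Y y) - leviCivita Y y (Z y)) x := by
    refine leviCivita_congr_of_eventuallyEq dYZ (mdifferentiableAt_sub_section d1 d2) ?_
    filter_upwards [eventually_mdiffAt hY, eventually_mdiffAt hZ] with y hYy hZy
    exact (leviCivita_torsion hYy hZy).symm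
  rw [h, leviCivita_sub d1 d2]
  rfl

/-- The first Bianchi identity. -/
theorem curvature_bianchi {x : M} {X Y Z : Π x : M, TangentSpace 𝓘(ℝ, E) x}
    (hX : CMDiffAt 2 (T% X) x) (hY : CMDiffAt 2 (T% Y) x) (hZ : CMDiffAt 2 (T% Z) x) :
    curvature X Y Z x + curvature Y Z X x + curvature Z X Y x = 0 := by
  have h1 := leviCivita_commutator hX hY hZ
  have h2 := leviCivita_commutator hY hZ hX
  have h3 := leviCivita_commutator hZ hX hY
  have : IsManifold 𝓘(ℝ, E) (minSmoothness ℝ 3) M := by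
    rw [minSmoothness_of_isRCLikeNormedField]; exact IsManifold.of_le (n := ∞) ENat.LEInfty.out
  have hJ := leibniz_identity_mlieBracket_apply (I := 𝓘(ℝ, E)) (x := x) (U := X) (V := Y)
    (W := Z) (by simpa using hX) (by simpa using hY) (by simpa using hZ)
  rw [mlieBracket_swap (V := X) (W := Z), mlieBracket_swap_apply (W := Z), ← h3, ← h1] at hJ
  have hn : mlieBracket 𝓘(ℝ, E) Y (-mlieBracket 𝓘(ℝ, E) Z X) x
      = -mlieBracket 𝓘(ℝ, E) Y (mlieBracket 𝓘(ℝ, E) Z X) x := by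
    have := mlieBracket_const_smul_right (I := 𝓘(ℝ, E)) (V := Y) (c := (-1 : ℝ))
      (mdiffAt_mlieBracket hZ hX)
    simpa using this
  rw [hn, ← h2, ← sub_eq_zero] at hJ
  rw [← hJ]
  simp only [curvature]
  abel

/-- The pair symmetry of the curvature tensor. -/
theorem inner_curvature_pair_symm {x : M} {X Y Z W : Π x : M, TangentSpace 𝓘(ℝ, E) x}
    (hX : CMDiffAt 2 (T% X) x) (hY : CMDiffAt 2 (T% Y) x) (hZ : CMDiffAt 2 (T% Z) x)
    (hW : CMDiffAt 2 (T% W) x) :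
    ⟪curvature X Y Z x, W x⟫ = ⟪curvature Z W X x, Y x⟫ := by
  have bianchi : ∀ {A B C D : Π x : M, TangentSpace 𝓘(ℝ, E) x}, CMDiffAt 2 (T% A) x →
      CMDiffAt 2 (T% B) x → CMDiffAt 2 (T% C) x →
      ⟪curvature A B C x, D x⟫ + ⟪curvature B C A x, D x⟫ + ⟪curvature C A B x, D x⟫ = 0 := by
    intro A B C D hA hB hC
    rw [← inner_add_left, ← inner_add_left, curvature_bianchi hA hB hC, inner_zero_left]
  have swap : ∀ A B C D : Π x : M, TangentSpace 𝓘(ℝ, E) x,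
      ⟪curvature A B C x, D x⟫ = -⟪curvature B A C x, D x⟫ := fun A B C D ↦ by
    rw [curvature_swap, inner_neg_left]
  -- Milnor's octahedron argument: the four Bianchi sums, combined using both skew-symmetries, give
  -- the pair symmetry.
  have b1 := bianchi (D := W) hX hY hZ
  have b2 := bianchi (D := X) hY hZ hW
  have b3 := bianchi (D := Y) hZ hW hX
  have b4 := bianchi (D := Z) hW hX hY
  have s1 := inner_curvature_skew hX hY hZ hW
  have s2 := inner_curvature_skew hY hZ hX hW
  have s3 := inner_curvature_skew hZ hX hY hW
  have s4 := inner_curvature_skew hZ hW hX hY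
  have s5 := inner_curvature_skew hW hX hY hZ
  have s6 := inner_curvature_skew hW hY hX hZ
  have t1 := swap X W Y Z
  have t2 := swap X W Z Y
  have t3 := swap W Y X Z
  have t4 := swap W Y Z X
  have t5 := swap Z X Y W
  have t6 := swap Z X W Y
  linarith

/-- The curvature at `x` depends only on the values at `x` of its arguments. -/
theorem curvature_congr {x : M} {X Y Z X' Y' Z' : Π x : M, TangentSpace 𝓘(ℝ, E) x}
    (hX : CMDiffAt 2 (T% X) x) (hY : CMDiffAt 2 (T% Y) x) (hZ : CMDiffAt 2 (T% Z) x)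
    (hX' : CMDiffAt 2 (T% X') x) (hY' : CMDiffAt 2 (T% Y') x) (hZ' : CMDiffAt 2 (T% Z') x)
    (eX : X x = X' x) (eY : Y x = Y' x) (eZ : Z x = Z' x) :
    curvature X Y Z x = curvature X' Y' Z' x := by
  refine ext_inner_right ℝ fun w ↦ ?_
  have hW : CMDiffAt 2 (T% (extend E w)) x := contMDiffAt_extend _ _ _
  -- In the last slot of g(R(X,Y)Z,W) only the value at x enters. The symmetries bring Z, Y and X
  -- there in turn to be replaced.
  have e : extend E w x = w := extend_apply_self _ _
  rw [← e, inner_curvature_skew hX hY hZ hW, eZ, ← inner_curvature_skew hX hY hZ' hW,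
    inner_curvature_pair_symm hX hY hZ' hW, eY, inner_curvature_skew hZ' hW hX hY', eX,
    ← inner_curvature_skew hZ' hW hX' hY', inner_curvature_pair_symm hZ' hW hX' hY']

end Curvature


theorem _root_.OrthonormalBasis.sum_real_inner_sq {ι F : Type*} [Fintype ι] [NormedAddCommGroup F]
    [InnerProductSpace ℝ F] (b : OrthonormalBasis ι ℝ F) (v : F) :
    ∑ i, inner ℝ (b i) v ^ 2 = inner ℝ v v := by
  rw [← b.sum_inner_mul_inner v v]
  exact Finset.sum_congr rfl fun i _ ↦ by rw [real_inner_comm v, sq]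

/-! ### Trans-Sasakian curvature identities and the soliton equation. -/

section AlmostContact

variable {E : Type*} [NormedAddCommGroup E] [NormedSpace ℝ E]
  {M : Type*} [TopologicalSpace M] [ChartedSpace E M] [IsManifold 𝓘(ℝ, E) ∞ M]
  [RiemannianBundle (fun x : M ↦ TangentSpace 𝓘(ℝ, E) x)]
  {φ : Π x : M, TangentSpace 𝓘(ℝ, E) x →L[ℝ] TangentSpace 𝓘(ℝ, E) x}
  {ξ : Π x : M, TangentSpace 𝓘(ℝ, E) x} {η : Π x : M, TangentSpace 𝓘(ℝ, E) x →L[ℝ] ℝ}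
  {α β : M → ℝ} {lam μ : ℝ}

local notation "⟪" v ", " w "⟫" => inner ℝ v w

theorem IsAlmostContactMetric.inner_xi_xi (h : IsAlmostContactMetric φ ξ η) (x : M) :
    ⟪ξ x, ξ x⟫ = 1 := by
  rw [← h.eta_eq, h.eta_xi]

theorem IsAlmostContactMetric.phi_xi (h : IsAlmostContactMetric φ ξ η) (x : M) :
    φ x (ξ x) = 0 := by
  have := h.inner_phi_phi x (ξ x) (ξ x)
  rw [h.inner_xi_xi, h.eta_xi, mul_one, sub_self] at this
  exact inner_self_eq_zero.1 this

theorem IsAlmostContactMetric.eta_phi (h : IsAlmostContactMetric φ ξ η) (x : M)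
    (u : TangentSpace 𝓘(ℝ, E) x) : η x (φ x u) = 0 := by
  have := h.inner_phi x (ξ x) u
  rwa [h.phi_xi, inner_zero_right, add_zero, real_inner_comm, ← h.eta_eq] at this

theorem IsAlmostContactMetric.inner_phi_self (h : IsAlmostContactMetric φ ξ η) (x : M)
    (u : TangentSpace 𝓘(ℝ, E) x) : ⟪φ x u, u⟫ = 0 := by
  have := h.inner_phi x u u
  rw [real_inner_comm]
  linarith

theorem IsAlmostContactMetric.contMDiffAt_phi (h : IsAlmostContactMetric φ ξ η) {x : M}
    {X : Π x : M, TangentSpace 𝓘(ℝ, E) x} (hX : CMDiffAt ∞ (T% X) x) :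
    CMDiffAt ∞ (T% (fun y ↦ φ y (X y))) x :=
  ContMDiffAt.clm_bundle_apply (b := fun y : M ↦ y) (h.smooth_phi x) hX

variable [IsContMDiffRiemannianBundle 𝓘(ℝ, E) ∞ E (fun x : M ↦ TangentSpace 𝓘(ℝ, E) x)]
  [FiniteDimensional ℝ E]

theorem IsAlmostContactMetric.inner_leviCivita_xi (h : IsAlmostContactMetric φ ξ η) (x : M)
    (u : TangentSpace 𝓘(ℝ, E) x) : ⟪leviCivita ξ x u, ξ x⟫ = 0 := by
  have hu := mdifferentiableAt_extend 𝓘(ℝ, E) E u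
  have hξ := (h.smooth_xi x).mdifferentiableAt (by simp)
  have := leviCivita_metric hu hξ hξ
  simp only [h.inner_xi_xi, extend_apply_self, mvfderiv_const, zero_apply] at this
  rw [real_inner_comm] at this ⊢
  linarith

/-- On a trans-Sasakian manifold `∇_u ξ = -α φu + β (u - η(u) ξ)`. -/
theorem IsTransSasakian.leviCivita_xi (h : IsTransSasakian φ ξ η α β) (x : M)
    (u : TangentSpace 𝓘(ℝ, E) x) :
    leviCivita ξ x u = -(α x • φ x u) + β x • (u - η x u • ξ x) := by
  have hφ := h.nabla_phi x (extend E u) ξ (contMDiffAt_extend _ _ _) (h.smooth_xi x)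
  have h0 : leviCivita (fun y ↦ φ y (ξ y)) x = 0 := by
    have e : (fun y ↦ φ y (ξ y)) = 0 := funext fun y ↦ h.phi_xi y
    rw [e, CovariantDerivative.zero]
    rfl
  rw [h0, extend_apply_self, ← h.eta_eq, ← h.eta_eq, h.eta_phi, h.eta_xi] at hφ
  -- Since ∇_u ξ is orthogonal to ξ, where φ² = -1, applying φ recovers it from φ(∇_u ξ).
  have h1 := congrArg (φ x) hφ
  simp only [zero_apply, map_sub, map_add, map_smul, h.phi_xi, h.phi_phi,
    map_zero] at h1
  rw [h.eta_eq x (leviCivita ξ x u), h.inner_leviCivita_xi] at h1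
  have h2 : leviCivita ξ x u = 0 - (-leviCivita ξ x u + (0 : ℝ) • ξ x) := by module
  rw [h2, h1]
  module

theorem IsTransSasakian.leviCivita_xi_xi (h : IsTransSasakian φ ξ η α β) (x : M) :
    leviCivita ξ x (ξ x) = 0 := by
  rw [h.leviCivita_xi, h.phi_xi, h.eta_xi]
  module

/-- The Jacobi operator `R(·, ξ)ξ` of a trans-Sasakian manifold. -/
theorem IsTransSasakian.curvature_xi_xi (h : IsTransSasakian φ ξ η α β) {x : M}
    {X : Π x : M, TangentSpace 𝓘(ℝ, E) x} (hX : CMDiffAt ∞ (T% X) x) :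
    curvature X ξ ξ x = (d% α x (ξ x) + 2 * α x * β x) • φ x (X x)
      + (α x ^ 2 - β x ^ 2 - d% β x (ξ x)) • (X x - η x (X x) • ξ x) := by
  have hξ := h.smooth_xi x
  have dX := hX.mdifferentiableAt (by simp)
  have dξ := hξ.mdifferentiableAt (by simp)
  have dφX := (h.contMDiffAt_phi hX).mdifferentiableAt (by simp)
  have dα : MDiffAt (fun y ↦ -α y) x := ((h.smooth_alpha x).mdifferentiableAt (by simp)).neg
  have dβ : MDiffAt β x := (h.smooth_beta x).mdifferentiableAt (by simp)
  have dη : MDiffAt (fun y ↦ η y (X y)) x := by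
    simp only [h.eta_eq]
    exact mdiffAt_inner dX dξ
  have dβη : MDiffAt (fun y ↦ -(β y * η y (X y))) x := (dβ.mul dη).neg
  have hcov := (leviCivita (E := E) (M := M)).isCovariantDerivativeOnUniv
  have e1 : (fun y ↦ leviCivita ξ y (ξ y)) = 0 := funext fun y ↦ h.leviCivita_xi_xi y
  have e2 : (fun y ↦ leviCivita ξ y (X y)) = ((fun y ↦ -α y) • fun y ↦ φ y (X y))
      + (β • X + (fun y ↦ -(β y * η y (X y))) • ξ) := by
    funext y
    simp only [h.leviCivita_xi, Pi.add_apply, Pi.smul_apply']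
    module
  -- The right side of the structure equation vanishes in the direction ξ, so ∇_ξ φ = 0.
  have hφX : leviCivita (fun y ↦ φ y (X y)) x (ξ x) = φ x (leviCivita X x (ξ x)) := by
    have := h.nabla_phi x ξ X hξ hX
    rw [h.phi_xi, inner_zero_left, real_inner_comm, ← h.eta_eq] at this
    rw [← sub_eq_zero, this]
    module
  have hη : d% (fun y ↦ η y (X y)) x (ξ x) = η x (leviCivita X x (ξ x)) := by
    simp only [h.eta_eq]
    rw [leviCivita_metric dξ dX dξ, h.leviCivita_xi_xi, inner_zero_right, add_zero]
  have h2 : leviCivita (fun y ↦ leviCivita ξ y (X y)) x (ξ x)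
      = -(d% α x (ξ x)) • φ x (X x) + (-α x) • φ x (leviCivita X x (ξ x))
        + (d% β x (ξ x) • X x + β x • leviCivita X x (ξ x)
          - (d% β x (ξ x) * η x (X x) + β x * η x (leviCivita X x (ξ x))) • ξ x) := by
    have a1 := hcov.leibniz dφX dα
    have a2 := hcov.leibniz dX dβ
    have a3 := hcov.leibniz dξ dβη
    have a4 := hcov.add (dβ.smul_section dX) (dβη.smul_section dξ)
    have a5 := hcov.add (dα.smul_section dφX)
      (mdifferentiableAt_add_section (dβ.smul_section dX) (dβη.smul_section dξ))
    rw [e2, a5, a1, a4, a2, a3, mvfderiv_fun_neg, mvfderiv_fun_neg, mvfderiv_fun_mul dβ dη]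
    simp only [add_apply, smul_apply, neg_apply, ContinuousLinearMap.smulRight_apply, hφX, hη,
      h.leviCivita_xi_xi, smul_eq_mul]
    module
  -- With [X,ξ] = ∇_X ξ - ∇_ξ X, all terms containing ∇_ξ X cancel.
  rw [curvature, e1, h2, ← leviCivita_torsion dX dξ]
  simp only [CovariantDerivative.zero, h.leviCivita_xi, Pi.zero_apply, zero_apply,
    map_sub, map_add, map_neg, map_smul, h.phi_phi, h.phi_xi, h.eta_phi, h.eta_xi, smul_eq_mul]
  module

/-- This is the trace of the orthogonal projection onto the complement of ξ. -/
theorem IsTransSasakian.sum_one_sub_eta_sq (h : IsTransSasakian φ ξ η α β) (x : M) :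
    ∑ i, ((1 : ℝ) - η x (stdOrthonormalBasis ℝ (TangentSpace 𝓘(ℝ, E) x) i) ^ 2)
      = (Module.finrank ℝ E : ℝ) - 1 := by
  simp only [Finset.sum_sub_distrib, h.eta_eq, OrthonormalBasis.sum_real_inner_sq, h.inner_xi_xi]
  simp
  rfl

theorem IsTransSasakian.inner_curvature_xi_xi (h : IsTransSasakian φ ξ η α β) {x : M}
    {X : Π x : M, TangentSpace 𝓘(ℝ, E) x} (hX : CMDiffAt ∞ (T% X) x) :
    ⟪curvature X ξ ξ x, X x⟫
      = (α x ^ 2 - β x ^ 2 - d% β x (ξ x)) * (⟪X x, X x⟫ - η x (X x) ^ 2) := by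
  rw [h.curvature_xi_xi hX, inner_add_left, inner_smul_left, inner_smul_left, inner_sub_left,
    inner_smul_left, h.inner_phi_self, real_inner_comm _ (ξ x), ← h.eta_eq]
  simp only [conj_trivial]
  ring

/-- On a trans-Sasakian manifold of dimension `n`, `S(ξ,ξ) = (n - 1) (α² - β² - ξ(β))`. -/
theorem IsTransSasakian.ricci_xi_xi (h : IsTransSasakian φ ξ η α β) (x : M) :
    ricci x (ξ x) (ξ x)
      = (α x ^ 2 - β x ^ 2 - d% β x (ξ x)) * (Module.finrank ℝ E - 1) := by
  rw [ricci, ← h.sum_one_sub_eta_sq x, Finset.mul_sum]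
  refine Finset.sum_congr rfl fun i _ ↦ ?_
  set e := stdOrthonormalBasis ℝ (TangentSpace 𝓘(ℝ, E) x) i with he
  have hX : CMDiffAt ∞ (T% (extend E e)) x := contMDiffAt_extend _ _ _
  have hX2 : CMDiffAt 2 (T% (extend E e)) x := contMDiffAt_extend _ _ _
  have hξ : CMDiffAt 2 (T% ξ) x := (h.smooth_xi x).of_le ENat.LEInfty.out
  have hξ' : CMDiffAt 2 (T% (extend E (ξ x))) x := contMDiffAt_extend _ _ _
  have hee : ⟪e, e⟫ = 1 := by
    rw [real_inner_self_eq_norm_sq, he, OrthonormalBasis.norm_eq_one]; norm_num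
  rw [curvature_congr hX2 hξ' hξ' hX2 hξ hξ rfl (extend_apply_self _ _) (extend_apply_self _ _)]
  have := h.inner_curvature_xi_xi hX
  rwa [extend_apply_self, hee] at this

/-- L_ξ g is twice the symmetric part of ∇ξ, and φ is skew, so α does not contribute. -/
theorem IsTransSasakian.lieDerivMetric_xi (h : IsTransSasakian φ ξ η α β) {x : M}
    {X Y : Π x : M, TangentSpace 𝓘(ℝ, E) x} (hX : MDiffAt (T% X) x) (hY : MDiffAt (T% Y) x) :
    lieDerivMetric ξ X Y x = 2 * β x * (⟪X x, Y x⟫ - η x (X x) * η x (Y x)) := by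
  have dξ := (h.smooth_xi x).mdifferentiableAt (by simp)
  have h1 := h.inner_phi x (X x) (Y x)
  rw [lieDerivMetric, leviCivita_metric dξ hX hY, ← leviCivita_torsion dξ hX,
    ← leviCivita_torsion dξ hY, h.leviCivita_xi, h.leviCivita_xi]
  simp only [inner_sub_left, inner_sub_right, inner_add_left, inner_add_right, inner_neg_left,
    inner_neg_right, inner_smul_left, inner_smul_right, conj_trivial]
  rw [real_inner_comm (Y x) (ξ x), ← h.eta_eq, ← h.eta_eq, real_inner_comm (Y x) (φ x (X x))]
  linear_combination -α x * h1

/-- The Ricci tensor of an `η`-Einstein soliton on a trans-Sasakian manifold. -/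
theorem IsEtaEinsteinSoliton.ricci_eq (hsol : IsEtaEinsteinSoliton ξ η lam μ)
    (h : IsTransSasakian φ ξ η α β) (x : M) (u v : TangentSpace 𝓘(ℝ, E) x) :
    ricci x u v = (scalarCurvature (E := E) x / 2 - lam - β x) * ⟪u, v⟫
      + (β x - μ) * (η x u * η x v) := by
  have h1 := hsol x (extend E u) (extend E v) (contMDiffAt_extend _ _ _) (contMDiffAt_extend _ _ _)
  rw [h.lieDerivMetric_xi (mdifferentiableAt_extend _ _ _) (mdifferentiableAt_extend _ _ _),
    extend_apply_self, extend_apply_self] at h1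
  linarith

theorem IsEtaEinsteinSoliton.scalarCurvature_eq (hsol : IsEtaEinsteinSoliton ξ η lam μ)
    (h : IsTransSasakian φ ξ η α β) (x : M) :
    scalarCurvature (E := E) x
      = (scalarCurvature (E := E) x / 2 - lam - β x) * Module.finrank ℝ E + (β x - μ) := by
  conv_lhs => rw [scalarCurvature]
  simp only [hsol.ricci_eq h, Finset.sum_add_distrib, ← Finset.mul_sum, h.eta_eq, ← sq,
    OrthonormalBasis.sum_real_inner_sq, h.inner_xi_xi, real_inner_self_eq_norm_sq,
    OrthonormalBasis.norm_eq_one]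
  simp
  exact Or.inl rfl

/-- If `R(ξ,X)·S = 0`, then `(β - μ) (α² - β² - ξ(β)) = 0` in dimension at least two. -/
theorem RicciSemisymmetricAlong.mul_eq_zero (hRS : RicciSemisymmetricAlong ξ)
    (hsol : IsEtaEinsteinSoliton ξ η lam μ) (h : IsTransSasakian φ ξ η α β) (x : M) :
    (β x - μ) * (α x ^ 2 - β x ^ 2 - d% β x (ξ x)) * (Module.finrank ℝ E - 1) = 0 := by
  rw [← h.sum_one_sub_eta_sq x, Finset.mul_sum]
  refine Finset.sum_eq_zero fun i _ ↦ ?_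
  set e := stdOrthonormalBasis ℝ (TangentSpace 𝓘(ℝ, E) x) i with he
  have hX : CMDiffAt ∞ (T% (extend E e)) x := contMDiffAt_extend _ _ _
  have hX2 : CMDiffAt 2 (T% (extend E e)) x := contMDiffAt_extend _ _ _
  have hξ : CMDiffAt 2 (T% ξ) x := (h.smooth_xi x).of_le ENat.LEInfty.out
  have hee : ⟪e, e⟫ = 1 := by
    rw [real_inner_self_eq_norm_sq, he, OrthonormalBasis.norm_eq_one]; norm_num
  -- Taking Y = ξ and Z = X = e, the g parts cancel by `h3`, and `h4` leaves only (β - μ) g(R(e,ξ)ξ,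
  -- e). Summing over the basis then gives the factor n - 1.
  have h1 := hRS x (extend E e) ξ (extend E e) hX (h.smooth_xi x) hX
  have h2 := h.inner_curvature_xi_xi hX
  have h3 := inner_curvature_skew hξ hX2 hX2 hξ
  have h4 : η x (curvature (extend E e) ξ ξ x) = 0 := by
    rw [h.curvature_xi_xi hX]
    simp only [map_add, map_sub, map_smul, h.eta_phi, h.eta_xi, smul_eq_mul]
    ring
  rw [hsol.ricci_eq h, hsol.ricci_eq h, real_inner_comm _ (ξ x), ← h.eta_eq, h.eta_xi,
    h.eta_eq x (curvature ξ (extend E e) (extend E e) x), h3, curvature_swap ξ, map_neg, h4,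
    inner_neg_left, h2, extend_apply_self, hee] at h1
  linarith

end AlmostContact

end RiemGeom

end

/-! ### The theorem in dimension three. -/

theorem theorem5p1 {M : Type*} [TopologicalSpace M] [ChartedSpace (EuclideanSpace ℝ (Fin 3)) M]
    [IsManifold 𝓘(ℝ, EuclideanSpace ℝ (Fin 3)) ∞ M]
    [RiemannianBundle (fun x : M ↦ TangentSpace 𝓘(ℝ, EuclideanSpace ℝ (Fin 3)) x)]
    [IsContMDiffRiemannianBundle 𝓘(ℝ, EuclideanSpace ℝ (Fin 3)) ∞ (EuclideanSpace ℝ (Fin 3))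
      (fun x : M ↦ TangentSpace 𝓘(ℝ, EuclideanSpace ℝ (Fin 3)) x)]
    (φ : Π x : M, TangentSpace 𝓘(ℝ, EuclideanSpace ℝ (Fin 3)) x →L[ℝ]
      TangentSpace 𝓘(ℝ, EuclideanSpace ℝ (Fin 3)) x)
    (ξ : Π x : M, TangentSpace 𝓘(ℝ, EuclideanSpace ℝ (Fin 3)) x)
    (η : Π x : M, TangentSpace 𝓘(ℝ, EuclideanSpace ℝ (Fin 3)) x →L[ℝ] ℝ)
    (α β : M → ℝ) (lam μ : ℝ)
    (hts : RiemGeom.IsTransSasakian φ ξ η α β)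
    (hsol : RiemGeom.IsEtaEinsteinSoliton ξ η lam μ)
    (hRS : RiemGeom.RicciSemisymmetricAlong ξ)
    (hαβ : ∀ x : M, ∃ y ∈ connectedComponent x, α y ^ 2 ≠ β y ^ 2) :
    (∀ x : M, β x = μ) ∧
    RiemGeom.IsEinstein (EuclideanSpace ℝ (Fin 3)) M ∧
    ∃ r₀ : ℝ, ∀ x : M,
      RiemGeom.scalarCurvature (E := EuclideanSpace ℝ (Fin 3)) x = r₀ ∧
        r₀ = 6 * lam + 6 * β x := by
  have hdim : (Module.finrank ℝ (EuclideanSpace ℝ (Fin 3)) : ℝ) = 3 := by simp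
  have hr : ∀ x : M, RiemGeom.scalarCurvature (E := EuclideanSpace ℝ (Fin 3)) x
      = 6 * lam + 4 * β x + 2 * μ := fun x ↦ by
    have h1 := hsol.scalarCurvature_eq hts x
    rw [hdim] at h1
    linarith
  have hξξ : ∀ x : M, α x ^ 2 - β x ^ 2
      - mvfderiv 𝓘(ℝ, EuclideanSpace ℝ (Fin 3)) β x (ξ x) = lam + β x := fun x ↦ by
    have h1 := hts.ricci_xi_xi x
    rw [hsol.ricci_eq hts, hts.inner_xi_xi, hts.eta_xi, hr, hdim] at h1
    linarith
  have hprod : ∀ x : M, (β x - μ) * (lam + β x) = 0 := fun x ↦ by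
    have h1 := hRS.mul_eq_zero hsol hts x
    rw [hξξ, hdim] at h1
    linarith
  have hβc : Continuous β := hts.smooth_beta.continuous
  have hβ : ∀ x : M, β x = μ := by
    intro x
    by_contra hx
    have hsub : β '' connectedComponent x ⊆ {μ, -lam} := by
      rintro _ ⟨y, -, rfl⟩
      rcases mul_eq_zero.1 (hprod y) with h | h
      · exact Or.inl (sub_eq_zero.1 h)
      · exact Or.inr (by simp only [Set.mem_singleton_iff]; linarith)
    -- A preconnected subset of ℝ with two points is infinite.
    have hss : (β '' connectedComponent x).Subsingleton := by
      by_contra hn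
      exact (isPreconnected_connectedComponent.image β hβc.continuousOn).infinite_of_nontrivial
        (Set.not_subsingleton_iff.1 hn) ((Set.toFinite _).subset hsub)
    obtain ⟨y, hy, hne⟩ := hαβ x
    have hyx : β y = β x := hss ⟨y, hy, rfl⟩ ⟨x, mem_connectedComponent, rfl⟩
    have hy' : β y ≠ μ := hyx ▸ hx
    -- Differentiating needs an open neighbourhood: β ≠ μ is an open condition, and there the
    -- product relation forces β = -λ.
    have hev : β =ᶠ[𝓝 y] fun _ ↦ -lam := by
      filter_upwards [hβc.continuousAt.eventually_ne hy'] with z hz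
      have := (mul_eq_zero.1 (hprod z)).resolve_left (sub_ne_zero.2 hz)
      linarith
    have hd : mvfderiv 𝓘(ℝ, EuclideanSpace ℝ (Fin 3)) β y (ξ y) = 0 := by
      rw [RiemGeom.mvfderiv_congr_of_eventuallyEq hev, mvfderiv_const]
      rfl
    have h1 := hξξ y
    rw [hd, hev.eq_of_nhds] at h1
    apply hne
    rw [hev.eq_of_nhds]
    linarith
  -- The Einstein constant is r/2 - λ - β at β = μ, r = 6λ + 6μ.
  refine ⟨hβ, ⟨2 * lam + 2 * μ, fun x u v ↦ ?_⟩, 6 * lam + 6 * μ, fun x ↦ ⟨?_, ?_⟩⟩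
  · rw [hsol.ricci_eq hts, hr, hβ]
    ring
  · rw [hr, hβ]
    ring
  · rw [hβ]
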